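/- Let $n\ge 0$ and let $\mathfrak S_n$ be the symmetric group on $\{1,\dots,n\}$; write $\sigma\in\mathfrak S_n$ as the word $\sigma(1)\sigma(2)\cdots\sigma(n)$. Let $\operatorname{fix}\sigma=\#\{i:\sigma(i)=i\}$, $\operatorname{inv}\sigma=\#\{(i,j):1\le i<j\le n,\ \sigma(i)>\sigma(j)\}$, $\operatorname{maj}\sigma=\sum i$, the sum being over all $i$ with $1\le i\le n-1$ and $\sigma(i)>\sigma(i+1)$, and $\operatorname{imaj}\sigma=\operatorname{maj}\sigma^{-1}$. A word $x_1x_2\cdots x_m$ with distinct integer letters is a desarrangement if it is empty or if there is $k\ge 1$ with $2k\le m$ such that $x_1>x_2>\cdots>x_{2k}$ and $x_{2k}<x_{2k+1}$, where $x_{m+1}=\infty$ by convention. Every $\sigma\in\mathfrak S_n$ factorizes as $\sigma=w^+w^d$, where $w^d$ is the longest right factor of the word $\sigma$ that is a desarrangement (the left factor $w^+$ is then increasing); let $\operatorname{pix}\sigma$ be the number of letters of $w^+$. Then, as polynomials in $q$ and $Y_0$, $$\sum_{\sigma\in\mathfrak S_n}q^{\operatorname{maj}\sigma}\,Y_0^{\operatorname{fix}\sigma}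 =\sum_{\sigma\in\mathfrak S_n}q^{\operatorname{inv}\sigma}\,Y_0^{\operatorname{pix}\sigma} =\sum_{\sigma\in\mathfrak S_n}q^{\operatorname{imaj}\sigma}\,Y_0^{\operatorname{pix}\sigma}.$$ -/

import Mathlib

namespace PermStat

/-- A word `x₁ x₂ ⋯ x_m` is a desarrangement if it is empty or if, for some `k ≥ 1`,
`x₁ > x₂ > ⋯ > x_{2k}` and `x_{2k} < x_{2k+1}`, with the convention `x_{m+1} = ∞`.
(List entries are numbered from `0`: `x_i` is `w[i - 1]`.) -/
def IsDesarrangement {α : Type*} [LinearOrder α] (w : List α) : Prop :=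
  w = [] ∨ ∃ k ∈ Finset.Icc 1 (w.length / 2),
    (w.take (2 * k)).Pairwise (fun a b => a > b) ∧
      ∀ h : 2 * k < w.length, w[2 * k - 1] < w[2 * k]

instance {α : Type*} [LinearOrder α] : DecidablePred (IsDesarrangement (α := α)) :=
  fun w => by unfold IsDesarrangement; infer_instance

theorem exists_drop_isDesarrangement {α : Type*} [LinearOrder α] (w : List α) :
    ∃ k, IsDesarrangement (w.drop k) :=
  ⟨w.length, Or.inl List.drop_length⟩

/-- The position at which the longest right factor of `w` that is a desarrangement starts. -/
def desarrangementStart {α : Type*} [LinearOrder α] (w : List α) : ℕ :=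
  Nat.find (exists_drop_isDesarrangement w)

/-- The longest right factor of `w` which is a desarrangement: the factor `w^d` of the pixed
factorization. -/
def desarrangementFactor {α : Type*} [LinearOrder α] (w : List α) : List α :=
  w.drop (desarrangementStart w)

/-- The left factor that remains once `w^d` is removed. For a word with positive letters, such as
that of a permutation, it is the factor `w⁺` of the pixed factorization (and `w⁻` is empty). -/
def pixedFactor {α : Type*} [LinearOrder α] (w : List α) : List α :=
  w.take (desarrangementStart w)

/-- The word `σ(1) σ(2) ⋯ σ(n)` with letters in `{1, …, n}`. -/
def word {n : ℕ} (σ : Equiv.Perm (Fin n)) : List ℕ :=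
  List.ofFn fun i => (σ i : ℕ) + 1

/-- The number of pixed points of `σ`. -/
def pix {n : ℕ} (σ : Equiv.Perm (Fin n)) : ℕ :=
  (pixedFactor (word σ)).toFinset.card

/-- The number of fixed points of `σ`. -/
def fix {n : ℕ} (σ : Equiv.Perm (Fin n)) : ℕ :=
  (Finset.univ.filter fun i => σ i = i).card

/-- The number of inversions of `σ`. -/
def inv {n : ℕ} (σ : Equiv.Perm (Fin n)) : ℕ :=
  (Finset.univ.filter fun p : Fin n × Fin n => p.1 < p.2 ∧ σ p.1 > σ p.2).card

/-- The ligne of route `{i : 1 ≤ i ≤ n - 1, σ(i) > σ(i + 1)}` (descent set). The index of the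
`i`-th letter in `Fin n` is `i - 1`. -/
def ligne {n : ℕ} (σ : Equiv.Perm (Fin n)) : Finset ℕ :=
  (Finset.Ico 1 n).filter fun i =>
    ∃ h : i < n, σ ⟨i - 1, (Nat.sub_le i 1).trans_lt h⟩ > σ ⟨i, h⟩

/-- The inverse ligne of route. -/
def iligne {n : ℕ} (σ : Equiv.Perm (Fin n)) : Finset ℕ :=
  ligne σ⁻¹

/-- The major index. -/
def maj {n : ℕ} (σ : Equiv.Perm (Fin n)) : ℕ :=
  ∑ i ∈ ligne σ, i

/-- The inverse major index. -/
def imaj {n : ℕ} (σ : Equiv.Perm (Fin n)) : ℕ :=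
  ∑ i ∈ iligne σ, i

end PermStat

/-! Each joint sum is expanded as `∑ gaussBinom q k m * A k * Y ^ m` over `k + m = n`, where `A k`
is the sum of `q ^ stat` over the permutations of `Fin k` with no fixed (or no pixed) point. A
permutation with `m` fixed points is a subset of size `m` together with a derangement; one with `m`
pixed points is a subset of size `m` (the letters of its increasing left factor) together with a
permutation whose word is a desarrangement. In both cases summing over the subset becomes a sum over
the ways to insert `m` copies of one letter into a fixed word (`maj_fixPerm`, `pixPerm_inv_lt_iff`),
and this contributes a Gaussian binomial (`sum_pow_majWord_shuffle`, `sum_pow_invWord_shuffle`).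

At `Y = 1` the expansions are the distributions of `maj`, `inv` and `imaj`, which agree by
MacMahon's theorem. The resulting system is triangular with diagonal coefficients `gaussBinom q n 0
= 1`, so the three sequences `A` agree, hence so do the joint sums. Derangements and desarrangements
are thus never matched by a bijection. The triangular system needs cancellation, so it is solved
over `ℕ[X]` and then evaluated at `q`. -/

namespace PermStat

/-! ### Gaussian binomials and the two q-Pascal rules. -/

/-- The Gaussian binomial coefficient `[k + m choose m]` at `q`. -/
def gaussBinom {R : Type*} [CommSemiring R] (q : R) : ℕ → ℕ → R
  | 0, _ => 1
  | _ + 1, 0 => 1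
  | k + 1, m + 1 => gaussBinom q (k + 1) m + q ^ (m + 1) * gaussBinom q k (m + 1)

section gaussBinom

variable {R : Type*} [CommSemiring R] (q : R)

@[simp] theorem gaussBinom_zero_left (m : ℕ) : gaussBinom q 0 m = 1 := by simp [gaussBinom]

@[simp] theorem gaussBinom_zero_right (k : ℕ) : gaussBinom q k 0 = 1 := by
  cases k <;> simp [gaussBinom]

theorem gaussBinom_succ_succ (k m : ℕ) : gaussBinom q (k + 1) (m + 1) =
    gaussBinom q (k + 1) m + q ^ (m + 1) * gaussBinom q k (m + 1) := by
  rw [gaussBinom]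

/-- The other q-Pascal rule. Both terms of the defining rule are expanded by the induction
hypotheses on `m` and on `k` and then reassembled, so no subtraction or division is needed. -/
theorem gaussBinom_succ_succ' (k m : ℕ) : gaussBinom q (k + 1) (m + 1) =
    q ^ (k + 1) * gaussBinom q (k + 1) m + gaussBinom q k (m + 1) := by
  induction k generalizing m with
  | zero =>
    induction m with
    | zero => simp [gaussBinom_succ_succ, add_comm]
    | succ m ih =>
      rw [gaussBinom_succ_succ q 0 (m + 1)]
      nth_rw 1 [ih]
      rw [gaussBinom_succ_succ q 0 m]
      simp only [gaussBinom_zero_left]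
      ring
  | succ k ihk =>
    induction m with
    | zero =>
      rw [gaussBinom_succ_succ q (k + 1) 0]
      nth_rw 1 [ihk]
      rw [gaussBinom_succ_succ q k 0]
      simp only [gaussBinom_zero_right]
      ring
    | succ m ih =>
      calc gaussBinom q (k + 1 + 1) (m + 1 + 1)
          = q ^ (k + 1 + 1) * gaussBinom q (k + 1 + 1) m + gaussBinom q (k + 1) (m + 1) +
            q ^ (m + 1 + 1) *
              (q ^ (k + 1) * gaussBinom q (k + 1) (m + 1) + gaussBinom q k (m + 1 + 1)) := by
            rw [gaussBinom_succ_succ q (k + 1) (m + 1), ih, ihk (m + 1)]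
        _ = _ := by
            rw [gaussBinom_succ_succ q (k + 1) m, gaussBinom_succ_succ q k (m + 1)]
            ring

end gaussBinom

/-! ### Inserting copies of one letter into a word. -/

section Shuffle

variable {L : Type*}

/-- The word which has the letter `c` at the positions in `S`, and the consecutive letters of `v` at
the other positions. -/
def shuffle (c : L) (v : ℕ → L) (S : Finset ℕ) (i : ℕ) : L :=
  if i ∈ S then c else v (Finset.range i \ S).card

variable {c : L} {v : ℕ → L} {S : Finset ℕ}

theorem shuffle_of_mem {i : ℕ} (h : i ∈ S) : shuffle c v S i = c := if_pos h

theorem shuffle_of_notMem {i : ℕ} (h : i ∉ S) :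
    shuffle c v S i = v (Finset.range i \ S).card := if_neg h

@[simp] theorem shuffle_empty : shuffle c v ∅ = v := by
  funext i; simp [shuffle]

theorem shuffle_insert_of_lt {n i : ℕ} (h : i < n) :
    shuffle c v (insert n S) i = shuffle c v S i := by
  have : Finset.range i \ insert n S = Finset.range i \ S := by
    ext j; simp only [Finset.mem_sdiff, Finset.mem_range, Finset.mem_insert]
    constructor
    · tauto
    · rintro ⟨h1, h2⟩; exact ⟨h1, by rintro (h | h); omega; exact h2 h⟩
  simp [shuffle, this, h.ne]

theorem shuffle_of_subset_range {n k m : ℕ} (hS : S ⊆ Finset.range n) (hm : S.card = m)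
    (h : k + m = n) : shuffle c v S n = v k := by
  rw [shuffle_of_notMem (fun h => by simpa using hS h), Finset.card_sdiff_of_subset hS,
    Finset.card_range, hm, ← h, Nat.add_sub_cancel]

/-- Copies of `c` are never counted, and the other letters met before position `n` form an initial
segment of `v`. -/
theorem card_filter_shuffle {P : L → Prop} [DecidablePred P] (hc : ¬ P c) (S : Finset ℕ) (n : ℕ) :
    ((Finset.range n).filter fun i => P (shuffle c v S i)).card =
      ((Finset.range (Finset.range n \ S).card).filter fun i => P (v i)).card := by
  induction n with
  | zero => simp
  | succ n ih =>
    rw [Finset.range_add_one, Finset.filter_insert]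
    by_cases h : n ∈ S
    · rw [shuffle_of_mem h, if_neg hc, ih, Finset.insert_sdiff_of_mem _ h]
    · rw [shuffle_of_notMem h, Finset.insert_sdiff_of_notMem _ h,
        Finset.card_insert_of_notMem (by simp), Finset.range_add_one, Finset.filter_insert]
      split_ifs
      · rw [Finset.card_insert_of_notMem (by simp), ih, Finset.card_insert_of_notMem (by simp)]
      · exact ih

end Shuffle

/-! ### Major index and inversions summed over all insertions. -/

section Words

variable {L : Type*} [LinearOrder L]

/-- The major index of the word `w 0, …, w (n - 1)`. -/
def majWord (n : ℕ) (w : ℕ → L) : ℕ :=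
  ∑ i ∈ Finset.range n, if 0 < i ∧ w i < w (i - 1) then i else 0

/-- The number of inversions of the word `w 0, …, w (n - 1)`. -/
def invWord (n : ℕ) (w : ℕ → L) : ℕ :=
  ∑ j ∈ Finset.range n, ((Finset.range j).filter fun i => w j < w i).card

theorem majWord_succ (n : ℕ) (w : ℕ → L) :
    majWord (n + 1) w = majWord n w + if 0 < n ∧ w n < w (n - 1) then n else 0 :=
  Finset.sum_range_succ _ _

theorem invWord_succ (n : ℕ) (w : ℕ → L) :
    invWord (n + 1) w = invWord n w + ((Finset.range n).filter fun i => w n < w i).card :=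
  Finset.sum_range_succ _ _

theorem majWord_congr {L' : Type*} [LinearOrder L'] {n : ℕ} {w : ℕ → L} {w' : ℕ → L'}
    (h : ∀ i, i + 1 < n → (w (i + 1) < w i ↔ w' (i + 1) < w' i)) :
    majWord n w = majWord n w' := by
  refine Finset.sum_congr rfl fun i hi => ?_
  rcases i with _ | i
  · simp
  · simp [h i (Finset.mem_range.1 hi)]

theorem invWord_congr {L' : Type*} [LinearOrder L'] {n : ℕ} {w : ℕ → L} {w' : ℕ → L'}
    (h : ∀ i j, i < j → j < n → (w j < w i ↔ w' j < w' i)) :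
    invWord n w = invWord n w' := by
  refine Finset.sum_congr rfl fun j hj => ?_
  congr 1
  refine Finset.filter_congr fun i hi => ?_
  exact h i j (Finset.mem_range.1 hi) (Finset.mem_range.1 hj)

variable {c : L} {v : ℕ → L} {S : Finset ℕ}

theorem majWord_shuffle_insert (n : ℕ) :
    majWord n (shuffle c v (insert n S)) = majWord n (shuffle c v S) := by
  refine majWord_congr fun i hi => ?_
  rw [shuffle_insert_of_lt hi, shuffle_insert_of_lt (by omega)]

theorem invWord_shuffle_insert (n : ℕ) :
    invWord n (shuffle c v (insert n S)) = invWord n (shuffle c v S) := by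
  refine invWord_congr fun i j hi hj => ?_
  rw [shuffle_insert_of_lt hj, shuffle_insert_of_lt (by omega)]

theorem sum_powersetCard_range_succ {M : Type*} [AddCommMonoid M] (f : Finset ℕ → M) (n m : ℕ) :
    ∑ S ∈ (Finset.range (n + 1)).powersetCard (m + 1), f S =
      ∑ S ∈ (Finset.range n).powersetCard (m + 1), f S +
        ∑ S ∈ (Finset.range n).powersetCard m, f (insert n S) := by
  have hmem : ∀ r, ∀ S ∈ (Finset.range n).powersetCard r, n ∉ S := fun r S hS h => by
    simpa using (Finset.mem_powersetCard.1 hS).1 h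
  rw [Finset.range_add_one, Finset.powersetCard_succ_insert Finset.notMem_range_self,
    Finset.sum_union, Finset.sum_image]
  · intro S hS T hT h
    have h' : insert n S = insert n T := h
    rw [← Finset.erase_insert (hmem _ S hS), h', Finset.erase_insert (hmem _ T hT)]
  · rw [Finset.disjoint_left]
    intro S hS hS'
    obtain ⟨T, -, rfl⟩ := Finset.mem_image.1 hS'
    exact hmem _ _ hS (Finset.mem_insert_self _ _)

variable {R : Type*} [CommSemiring R] (q : R)

/-- Refinement by the last letter, `v k` or `c`, of a word of length `n + 1`. The last two letters
decide whether the last step is a descent, so the two sums together satisfy a closed recursion. -/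
theorem sum_pow_majWord_shuffle_aux (hv : ∀ i, v i ≠ c) (n : ℕ) : ∀ k m, k + m = n →
    (∑ S ∈ (Finset.range n).powersetCard m, q ^ majWord (n + 1) (shuffle c v S) =
      q ^ majWord (k + 1) v * (if c < v k then 1 else q ^ m) * gaussBinom q k m) ∧
    (∑ S ∈ (Finset.range n).powersetCard m, q ^ majWord (n + 1) (shuffle c v (insert n S)) =
      q ^ majWord k v * (if 0 < k ∧ c < v (k - 1) then q ^ k else 1) * gaussBinom q k m) := by
  induction n with
  | zero =>
    intro k m h
    obtain ⟨rfl, rfl⟩ : k = 0 ∧ m = 0 := by omega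
    simp [majWord]
  | succ n ih =>
    intro k m h
    rcases m with _ | m
    · obtain rfl : k = n + 1 := h
      simp only [Finset.powersetCard_zero, Finset.sum_singleton, shuffle_empty, mul_one,
        gaussBinom_zero_right]
      constructor
      · simp
      rw [majWord_succ, majWord_shuffle_insert, shuffle_of_mem (Finset.mem_insert_self _ _),
        shuffle_insert_of_lt (by omega), shuffle_empty, pow_add]
      split_ifs <;> simp
    rcases k with _ | k
    · obtain rfl : m = n := by omega
      have hall : ∀ l, majWord l (shuffle c v (Finset.range l)) = 0 := fun l => by
        refine Finset.sum_eq_zero fun i hi => if_neg ?_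
        have := Finset.mem_range.1 hi
        rw [shuffle_of_mem hi, shuffle_of_mem (Finset.mem_range.2 (by omega))]
        simp
      have hcard : (Finset.range (m + 1)).powersetCard (m + 1) = {Finset.range (m + 1)} := by
        have := Finset.powersetCard_self (Finset.range (m + 1))
        rwa [Finset.card_range] at this
      rw [hcard, Finset.sum_singleton, Finset.sum_singleton]
      constructor
      · rw [majWord_succ, hall, shuffle_of_subset_range (k := 0) subset_rfl (Finset.card_range _) h,
          shuffle_of_mem (by simp)]
        rcases lt_or_gt_of_ne (hv 0) with h0 | h0
        · simp [h0, h0.not_gt, majWord]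
        · simp [h0, h0.not_gt, majWord]
      · rw [← Finset.range_add_one, hall]
        simp [majWord]
    obtain rfl : n = k + (m + 1) := by omega
    obtain ⟨hX, -⟩ := ih k (m + 1) rfl
    obtain ⟨-, hC⟩ := ih (k + 1) m (by omega)
    rw [sum_powersetCard_range_succ, sum_powersetCard_range_succ]
    have hs : ∀ r, ∀ S ∈ (Finset.range (k + (m + 1))).powersetCard r,
        S ⊆ Finset.range (k + (m + 1)) ∧ S.card = r := fun r S hS => Finset.mem_powersetCard.1 hS
    set n := k + (m + 1) with hn
    have hs' : ∀ S ∈ (Finset.range n).powersetCard m,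
        insert n S ⊆ Finset.range (n + 1) ∧ (insert n S).card = m + 1 := fun S hS => by
      obtain ⟨h1, h2⟩ := hs _ S hS
      refine ⟨?_, by rw [Finset.card_insert_of_notMem (fun h => by simpa using h1 h), h2]⟩
      rw [Finset.range_add_one]
      exact Finset.insert_subset_insert _ h1
    -- The four pairs (penultimate letter, last letter) are treated in turn: `v v`, `c v`, `v c`, `c
    -- c`.
    have e1 : ∑ S ∈ (Finset.range n).powersetCard (m + 1), q ^ majWord (n + 1 + 1) (shuffle c v S) =
        (∑ S ∈ (Finset.range n).powersetCard (m + 1), q ^ majWord (n + 1) (shuffle c v S)) *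
          q ^ (if v (k + 1) < v k then n + 1 else 0) := by
      rw [Finset.sum_mul]
      refine Finset.sum_congr rfl fun S hS => ?_
      obtain ⟨h1, h2⟩ := hs _ S hS
      rw [majWord_succ, pow_add, shuffle_of_subset_range (k := k + 1)
        (h1.trans (Finset.range_mono (Nat.le_succ _))) h2 (by omega), Nat.add_sub_cancel,
        shuffle_of_subset_range (k := k) h1 h2 (by omega)]
      simp
    have e2 : ∑ S ∈ (Finset.range n).powersetCard m,
          q ^ majWord (n + 1 + 1) (shuffle c v (insert n S)) =
        (∑ S ∈ (Finset.range n).powersetCard m, q ^ majWord (n + 1) (shuffle c v (insert n S))) *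
          q ^ (if v (k + 1) < c then n + 1 else 0) := by
      rw [Finset.sum_mul]
      refine Finset.sum_congr rfl fun S hS => ?_
      obtain ⟨h1, h2⟩ := hs' S hS
      rw [majWord_succ, pow_add, shuffle_of_subset_range (k := k + 1)
        h1 h2 (by omega), Nat.add_sub_cancel, shuffle_of_mem (Finset.mem_insert_self _ _)]
      simp
    have e3 : ∑ S ∈ (Finset.range n).powersetCard (m + 1),
          q ^ majWord (n + 1 + 1) (shuffle c v (insert (n + 1) S)) =
        (∑ S ∈ (Finset.range n).powersetCard (m + 1), q ^ majWord (n + 1) (shuffle c v S)) *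
          q ^ (if c < v k then n + 1 else 0) := by
      rw [Finset.sum_mul]
      refine Finset.sum_congr rfl fun S hS => ?_
      obtain ⟨h1, h2⟩ := hs _ S hS
      rw [majWord_succ, pow_add, majWord_shuffle_insert, shuffle_of_mem (Finset.mem_insert_self _ _),
        Nat.add_sub_cancel, shuffle_insert_of_lt (Nat.lt_succ_self _),
        shuffle_of_subset_range (k := k) h1 h2 (by omega)]
      simp
    have e4 : ∑ S ∈ (Finset.range n).powersetCard m,
          q ^ majWord (n + 1 + 1) (shuffle c v (insert (n + 1) (insert n S))) =
        ∑ S ∈ (Finset.range n).powersetCard m, q ^ majWord (n + 1) (shuffle c v (insert n S)) := by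
      refine Finset.sum_congr rfl fun S hS => ?_
      rw [majWord_succ, majWord_shuffle_insert, shuffle_of_mem (Finset.mem_insert_self _ _),
        Nat.add_sub_cancel, shuffle_insert_of_lt (Nat.lt_succ_self _),
        shuffle_of_mem (Finset.mem_insert_self _ _)]
      simp
    rw [e1, e2, e3, e4, hX, hC, majWord_succ (k + 1) v]
    simp only [Nat.add_sub_cancel, Nat.succ_pos, true_and]
    have hn1 : n + 1 = k + 1 + (m + 1) := by omega
    have hvk := hv k
    have hvk' := hv (k + 1)
    constructor
    -- The relative order of `v k`, `v (k + 1)` and `c` decides which Pascal rule applies; two of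
    -- the eight cases contradict transitivity.
    · rcases lt_or_gt_of_ne hvk with h0 | h0 <;> rcases lt_or_gt_of_ne hvk' with h1 | h1 <;>
        by_cases h2 : v (k + 1) < v k <;> simp only [h0, h1, h2, h0.not_gt, h1.not_gt, if_true, if_false]
      · rw [gaussBinom_succ_succ, hn1]; ring
      · rw [gaussBinom_succ_succ', hn1]; ring
      · exact absurd (h0.trans h1) h2.not_gt
      · rw [gaussBinom_succ_succ]; ring
      · rw [gaussBinom_succ_succ', hn1]; ring
      · exact absurd (h1.trans h0) h2
      · rw [gaussBinom_succ_succ, hn1]; ring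
      · rw [gaussBinom_succ_succ']; ring
    · rcases lt_or_gt_of_ne hvk with h0 | h0 <;> simp only [h0, h0.not_gt, if_true, if_false]
      · rw [gaussBinom_succ_succ]; ring
      · rw [gaussBinom_succ_succ, hn1]; ring

/-- A special case of the Garsia–Gessel theorem on the major index of shuffles. -/
theorem sum_pow_majWord_shuffle (hv : ∀ i, v i ≠ c) (k m : ℕ) :
    ∑ S ∈ (Finset.range (k + m)).powersetCard m, q ^ majWord (k + m) (shuffle c v S) =
      q ^ majWord k v * gaussBinom q k m := by
  rcases m with _ | m
  · simp
  rw [← add_assoc, sum_powersetCard_range_succ,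
    (sum_pow_majWord_shuffle_aux q hv (k + m) k m rfl).2]
  rcases k with _ | k
  · rw [Finset.powersetCard_eq_empty.2 (by simp)]
    simp
  · rw [(sum_pow_majWord_shuffle_aux q hv (k + 1 + m) k (m + 1) (by omega)).1]
    rcases lt_or_gt_of_ne (hv k) with h | h
    · simp only [h.not_gt, if_false, Nat.add_sub_cancel, and_false]
      rw [gaussBinom_succ_succ]; ring
    · simp only [h, if_true, Nat.add_sub_cancel, and_true, Nat.succ_pos]
      rw [gaussBinom_succ_succ']; ring

/-- A final `c`, being smaller than every letter of `v`, adds one inversion per letter of `v`; a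
final letter of `v` forms no inversion with the copies of `c`. This is the second Pascal rule.
Unlike for `majWord`, here `c` has to lie below all letters. -/
theorem sum_pow_invWord_shuffle (hv : ∀ i, c < v i) (k m : ℕ) :
    ∑ S ∈ (Finset.range (k + m)).powersetCard m, q ^ invWord (k + m) (shuffle c v S) =
      q ^ invWord k v * gaussBinom q k m := by
  induction h : k + m generalizing k m with
  | zero =>
    obtain ⟨rfl, rfl⟩ : k = 0 ∧ m = 0 := by omega
    simp [invWord]
  | succ n ih =>
    rcases m with _ | m
    · obtain rfl : k = n + 1 := h
      simp
    have hs : ∀ r l, l + r = n → ∀ S ∈ (Finset.range n).powersetCard r,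
        n ∉ S ∧ (Finset.range n \ S).card = l := fun r l hl S hS => by
      obtain ⟨h1, h2⟩ := Finset.mem_powersetCard.1 hS
      refine ⟨fun h => by simpa using h1 h, ?_⟩
      rw [Finset.card_sdiff_of_subset h1, h2, Finset.card_range]; omega
    have e2 : ∑ S ∈ (Finset.range n).powersetCard m,
          q ^ invWord (n + 1) (shuffle c v (insert n S)) =
        (∑ S ∈ (Finset.range n).powersetCard m, q ^ invWord n (shuffle c v S)) * q ^ k := by
      rw [Finset.sum_mul]
      refine Finset.sum_congr rfl fun S hS => ?_
      obtain ⟨h1, h2⟩ := hs m k (by omega) S hS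
      rw [invWord_succ, invWord_shuffle_insert, pow_add,
        shuffle_of_mem (Finset.mem_insert_self _ _), Finset.filter_congr fun i hi => by
          rw [shuffle_insert_of_lt (Finset.mem_range.1 hi)],
        card_filter_shuffle (P := fun x => c < x) (lt_irrefl c), h2]
      simp [hv]
    rw [sum_powersetCard_range_succ, e2, ih k m (by omega)]
    rcases k with _ | k
    · rw [Finset.powersetCard_eq_empty.2 (by simp; omega)]
      simp
    have e1 : ∑ S ∈ (Finset.range n).powersetCard (m + 1), q ^ invWord (n + 1) (shuffle c v S) =
        (∑ S ∈ (Finset.range n).powersetCard (m + 1), q ^ invWord n (shuffle c v S)) *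
          q ^ ((Finset.range k).filter fun i => v k < v i).card := by
      rw [Finset.sum_mul]
      refine Finset.sum_congr rfl fun S hS => ?_
      obtain ⟨h1, h2⟩ := hs (m + 1) k (by omega) S hS
      rw [invWord_succ, pow_add, shuffle_of_notMem h1, h2,
        card_filter_shuffle (P := fun x => v k < x) (hv k).not_gt, h2]
    rw [e1, ih k (m + 1) (by omega), invWord_succ, gaussBinom_succ_succ', pow_add]
    ring

end Words

/-! ### Desarrangements and the pixed factorization. -/

section Desarrangement

variable {α : Type*} [LinearOrder α]

theorem not_isDesarrangement_singleton (x : α) : ¬ IsDesarrangement [x] := by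
  simp [IsDesarrangement]

theorem not_isDesarrangement_of_lt {x y : α} {l : List α} (h : x < y) :
    ¬ IsDesarrangement (x :: y :: l) := by
  rintro (h' | ⟨k, hk, h1, -⟩)
  · simp at h'
  · obtain ⟨k, rfl⟩ : ∃ k', k = k' + 1 := ⟨k - 1, by have := (Finset.mem_Icc.1 hk).1; omega⟩
    rw [show 2 * (k + 1) = 2 * k + 1 + 1 by ring] at h1
    simp only [List.take_succ_cons, List.pairwise_cons] at h1
    exact absurd (h1.1 y (by simp)) h.not_gt

theorem isDesarrangement_cons_cons {x y : α} {l : List α} (h : y < x) :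
    IsDesarrangement (x :: y :: l) ↔
      (∀ z ∈ l.head?, y < z) ∨ ((∀ z ∈ l.head?, z < y) ∧ IsDesarrangement l) := by
  constructor
  · rintro (h' | ⟨k, hk, h1, h2⟩)
    · simp at h'
    simp only [Finset.mem_Icc, List.length_cons] at hk
    obtain ⟨k, rfl⟩ : ∃ k', k = k' + 1 := ⟨k - 1, by omega⟩
    rcases l with _ | ⟨z, l⟩
    · simp
    rcases k with _ | k
    · left
      simpa using h2
    · right
      rw [show 2 * (k + 1 + 1) = 2 * (k + 1) + 1 + 1 by ring] at h1
      simp only [List.take_succ_cons (as := y :: z :: l), List.take_succ_cons (as := z :: l),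
        List.pairwise_cons] at h1
      refine ⟨?_, Or.inr ⟨k + 1, ?_, h1.2.2, fun h => ?_⟩⟩
      · intro w hw
        obtain rfl : z = w := by simpa using hw
        exact h1.2.1 z (by simp [mul_add])
      · simp only [List.length_cons] at hk
        simp only [Finset.mem_Icc, List.length_cons]
        omega
      · exact h2 (by simp only [List.length_cons] at h ⊢; omega)
  · rintro (h1 | ⟨h1, rfl | ⟨k, hk, h2, h3⟩⟩)
    · refine Or.inr ⟨1, ?_, ?_, ?_⟩
      · simp only [Finset.mem_Icc, List.length_cons]; omega
      · simp [h]
      · rcases l with _ | ⟨z, l⟩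
        · simp
        · simpa using h1
    · refine Or.inr ⟨1, ?_, ?_, ?_⟩ <;> simp [h]
    · simp only [Finset.mem_Icc] at hk
      rcases l with _ | ⟨z, l⟩
      · simp at hk; omega
      have hzy : z < y := h1 z (by simp)
      have hlt : ∀ w ∈ (z :: l).take (2 * k), w < y := fun w hw => by
        obtain ⟨j, hj⟩ : ∃ j, 2 * k = j + 1 := ⟨2 * k - 1, by omega⟩
        rw [hj, List.take_succ_cons] at hw h2
        rcases List.mem_cons.1 hw with rfl | hw
        · exact hzy
        · exact ((List.pairwise_cons.1 h2).1 w hw).trans hzy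
      refine Or.inr ⟨k + 1, ?_, ?_, fun h' => ?_⟩
      · simp only [Finset.mem_Icc, List.length_cons] at hk ⊢
        omega
      · rw [show 2 * (k + 1) = 2 * k + 1 + 1 by ring, List.take_succ_cons, List.take_succ_cons]
        simp only [List.pairwise_cons, List.mem_cons]
        refine ⟨?_, hlt, h2⟩
        rintro w (rfl | hw)
        · exact h
        · exact (hlt w hw).trans h
      · obtain ⟨j, rfl⟩ : ∃ j, k = j + 1 := ⟨k - 1, by omega⟩
        exact h3 (by simp only [List.length_cons] at h' ⊢; omega)

/-- For distinct letters, a desarrangement is a word whose initial decreasing run has even length;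
prepending a larger letter changes the parity of that run. -/
theorem isDesarrangement_cons_iff_not {x y : α} {l : List α} (h : y < x) (hl : (y :: l).Nodup) :
    IsDesarrangement (x :: y :: l) ↔ ¬ IsDesarrangement (y :: l) := by
  induction l generalizing x y with
  | nil => simp [isDesarrangement_cons_cons h, not_isDesarrangement_singleton]
  | cons z l ih =>
    have hyz : y ≠ z := by rintro rfl; simp at hl
    rw [isDesarrangement_cons_cons h]
    rcases lt_or_gt_of_ne hyz with h1 | h1
    · simp [h1, not_isDesarrangement_of_lt]
    · rw [ih h1 (List.nodup_cons.1 hl).2]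
      simp [h1, h1.not_gt]

theorem isDesarrangement_map {β : Type*} [LinearOrder β] {f : α → β} (hf : StrictMono f)
    (w : List α) : IsDesarrangement (w.map f) ↔ IsDesarrangement w := by
  simp [IsDesarrangement, ← List.map_take, List.pairwise_map, hf.lt_iff_lt]

theorem desarrangementStart_le_length (w : List α) : desarrangementStart w ≤ w.length :=
  Nat.find_min' _ (Or.inl List.drop_length)

/-- At a descent exactly one of two consecutive nonempty suffixes is a desarrangement, and no suffix
starting with an ascent is one. Hence the suffixes before `m` all fail exactly when the first `m`
letters increase; the step from letter `m` to letter `m + 1` may go either way. -/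
theorem desarrangementStart_eq_iff {w : List α} (hw : w.Nodup) {m : ℕ} (hm : m ≤ w.length) :
    desarrangementStart w = m ↔
      (w.take m).Pairwise (· < ·) ∧ IsDesarrangement (w.drop m) := by
  have key : ∀ i (hi : i + 1 < w.length),
      w.drop i = w[i] :: w[i + 1] :: w.drop (i + 2) := fun i hi => by
    rw [List.drop_eq_getElem_cons (by omega), List.drop_eq_getElem_cons hi]
  rw [desarrangementStart, Nat.find_eq_iff, and_comm]
  refine and_congr_left fun hd => ?_
  rw [← List.isChain_iff_pairwise, List.isChain_iff_getElem]
  simp only [List.length_take, List.getElem_take]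
  constructor
  · intro h i hi
    have hi' : i + 1 < w.length := by omega
    have hne : w[i] ≠ w[i + 1] := fun h => by
      have := (List.Nodup.getElem_inj_iff hw).1 h
      omega
    by_contra hlt
    have hgt := lt_of_le_of_ne (not_lt.1 hlt) hne.symm
    have h1 := h i (by omega)
    rw [key i hi', isDesarrangement_cons_iff_not hgt, ← List.drop_eq_getElem_cons] at h1
    · exact h1 (h (i + 1) (by omega))
    · rw [← List.drop_eq_getElem_cons]
      exact hw.sublist (List.drop_sublist _ _)
  · intro h i hi
    by_cases him : i + 1 = m
    · by_cases hl : i + 1 = w.length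
      · rw [List.drop_eq_getElem_cons (by omega), List.drop_of_length_le (by omega)]
        exact not_isDesarrangement_singleton _
      · have hi' : i + 1 < w.length := by omega
        have hne : w[i] ≠ w[i + 1] := fun h => by
          have := (List.Nodup.getElem_inj_iff hw).1 h
          omega
        rw [key i hi']
        rcases lt_or_gt_of_ne hne with h1 | h1
        · exact not_isDesarrangement_of_lt h1
        · rw [isDesarrangement_cons_iff_not h1, not_not, ← List.drop_eq_getElem_cons, him]
          · exact hd
          · rw [← List.drop_eq_getElem_cons]
            exact hw.sublist (List.drop_sublist _ _)
    · rw [key i (by omega)]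
      exact not_isDesarrangement_of_lt (h i (by omega))

end Desarrangement

/-! ### Pixed points read off the word. -/

section Pix

variable {n : ℕ}

@[simp] theorem length_word (σ : Equiv.Perm (Fin n)) : (word σ).length = n := by simp [word]

@[simp] theorem getElem_word (σ : Equiv.Perm (Fin n)) {i : ℕ} (h : i < (word σ).length) :
    (word σ)[i] = (σ ⟨i, by simpa using h⟩ : ℕ) + 1 := by simp [word]

theorem nodup_word (σ : Equiv.Perm (Fin n)) : (word σ).Nodup :=
  List.nodup_ofFn.2 fun i j h => σ.injective (Fin.ext (by simpa using h))

theorem pix_eq_desarrangementStart (σ : Equiv.Perm (Fin n)) :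
    pix σ = desarrangementStart (word σ) := by
  rw [pix, pixedFactor, List.toFinset_card_of_nodup ((nodup_word σ).sublist (List.take_sublist _ _)),
    List.length_take, min_eq_left (desarrangementStart_le_length _)]

theorem pix_le (σ : Equiv.Perm (Fin n)) : pix σ ≤ n := by
  rw [pix_eq_desarrangementStart]
  exact (desarrangementStart_le_length _).trans_eq (length_word σ)

theorem pix_eq_iff (σ : Equiv.Perm (Fin n)) {m : ℕ} (hm : m ≤ n) :
    pix σ = m ↔ (∀ i j : Fin n, i < j → (j : ℕ) < m → σ i < σ j) ∧
      IsDesarrangement ((word σ).drop m) := by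
  rw [pix_eq_desarrangementStart, desarrangementStart_eq_iff (nodup_word σ) (by simpa using hm),
    List.pairwise_iff_getElem]
  refine and_congr_left fun _ => ⟨fun h i j hij hj => ?_, fun h i j hi hj hij => ?_⟩
  · have := h i j (by simp; omega) (by simp; omega) hij
    simpa using this
  · simp only [List.length_take, length_word] at hj
    simpa using h ⟨i, by omega⟩ ⟨j, by omega⟩ hij (by simp; omega)

end Pix

/-! ### Subsets of `Fin n` as shuffles. -/

section Subsets

variable {n k m : ℕ}

/-- The increasing enumeration of `S`, followed by that of its complement. -/
def subsetEquiv (h : k + m = n) (S : {S : Finset (Fin n) // S.card = m}) : Fin m ⊕ Fin k ≃ Fin n :=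
  finSumEquivOfFinset S.2 (by rw [Finset.card_compl, S.2, Fintype.card_fin]; omega)

variable (h : k + m = n) (S : {S : Finset (Fin n) // S.card = m})

theorem subsetEquiv_inl_lt_iff {a b : Fin m} :
    subsetEquiv h S (Sum.inl a) < subsetEquiv h S (Sum.inl b) ↔ a < b := by
  simp [subsetEquiv]

theorem subsetEquiv_inr_lt_iff {a b : Fin k} :
    subsetEquiv h S (Sum.inr a) < subsetEquiv h S (Sum.inr b) ↔ a < b := by
  simp [subsetEquiv]

theorem subsetEquiv_inl_mem (a : Fin m) : subsetEquiv h S (Sum.inl a) ∈ S.1 := by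
  simp [subsetEquiv]

theorem subsetEquiv_inr_notMem (a : Fin k) : subsetEquiv h S (Sum.inr a) ∉ S.1 := by
  rw [← Finset.mem_compl, subsetEquiv, finSumEquivOfFinset_inr]
  exact Finset.orderEmbOfFin_mem _ _ _

theorem subsetEquiv_mem_iff {x : Fin m ⊕ Fin k} :
    subsetEquiv h S x ∈ S.1 ↔ ∃ a, x = Sum.inl a := by
  rcases x with a | a
  · simp [subsetEquiv_inl_mem]
  · simp [subsetEquiv_inr_notMem]

variable {L : Type*} (c : L) (v : ℕ → L)

theorem shuffle_subsetEquiv_inl (a : Fin m) :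
    shuffle c v (S.1.map Fin.valEmbedding) (subsetEquiv h S (Sum.inl a) : ℕ) = c :=
  shuffle_of_mem (Finset.mem_map_of_mem Fin.valEmbedding (subsetEquiv_inl_mem h S a))

/-- The positions outside `S` before the one indexed by `b` are those indexed by `Iio b`, so there
are `b` of them. -/
theorem shuffle_subsetEquiv_inr (b : Fin k) :
    shuffle c v (S.1.map Fin.valEmbedding) (subsetEquiv h S (Sum.inr b) : ℕ) = v b := by
  rw [shuffle_of_notMem]
  · congr 1
    have : Finset.range (subsetEquiv h S (Sum.inr b) : ℕ) \ S.1.map Fin.valEmbedding =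
        (Finset.Iio b).map ⟨fun j => (subsetEquiv h S (Sum.inr j) : ℕ), fun i j hij => by
          simpa using (subsetEquiv h S).injective (Fin.ext hij)⟩ := by
      ext i
      simp only [Finset.mem_sdiff, Finset.mem_range, Finset.mem_map, Fin.valEmbedding_apply,
        Finset.mem_Iio]
      constructor
      · rintro ⟨h1, h2⟩
        obtain ⟨x, hx⟩ := (subsetEquiv h S).surjective ⟨i, by omega⟩
        rcases x with a | j
        · exact absurd ⟨_, subsetEquiv_inl_mem h S a, by rw [hx]⟩ h2
        · refine ⟨j, (subsetEquiv_inr_lt_iff h S).1 ?_, congrArg Fin.val hx⟩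
          rw [hx]; exact h1
      · rintro ⟨j, hj, rfl⟩
        refine ⟨(subsetEquiv_inr_lt_iff h S).2 hj, ?_⟩
        rintro ⟨a, ha, h3⟩
        rw [Fin.ext h3] at ha
        exact subsetEquiv_inr_notMem h S j ha
    rw [this, Finset.card_map, Fin.card_Iio]
  · rw [Finset.mem_map]
    rintro ⟨a, ha, h3⟩
    rw [Fin.ext h3] at ha
    exact subsetEquiv_inr_notMem h S b ha

theorem sum_subsets_eq {M : Type*} [AddCommMonoid M] (f : Finset ℕ → M) :
    ∑ S : {S : Finset (Fin n) // S.card = m}, f (S.1.map Fin.valEmbedding) =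
      ∑ S ∈ (Finset.range n).powersetCard m, f S := by
  have hr : Finset.range n = (Finset.univ : Finset (Fin n)).map Fin.valEmbedding := by
    rw [Fin.map_valEmbedding_univ]; ext; simp
  rw [hr, Finset.powersetCard_map, Finset.sum_map]
  exact (Finset.sum_subtype _ (fun _ => Finset.mem_powersetCard_univ)
    fun S => f (S.map Fin.valEmbedding)).symm

end Subsets

/-! ### Permutation statistics as word statistics. -/

section Statistics

variable {n : ℕ} {L : Type*} [LinearOrder L]

theorem maj_eq_majWord {σ : Equiv.Perm (Fin n)} {w : ℕ → L}
    (h : ∀ i j : Fin n, (j : ℕ) = i + 1 → (σ j < σ i ↔ w j < w i)) : maj σ = majWord n w := by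
  rw [maj, ligne, Finset.sum_filter, majWord, Finset.range_eq_Ico]
  rcases n with _ | n
  · simp
  rw [← Finset.sum_sdiff (Finset.Ico_subset_Ico_left (Nat.zero_le 1)), Finset.sum_eq_zero (s := _ \ _),
    zero_add]
  · refine Finset.sum_congr rfl fun i hi => ?_
    obtain ⟨h1, h2⟩ := Finset.mem_Ico.1 hi
    have := h ⟨i - 1, by omega⟩ ⟨i, h2⟩ (by simp; omega)
    simp only [gt_iff_lt, this, h2, exists_true_left, show 0 < i by omega, true_and]
  · intro i hi
    obtain rfl : i = 0 := by simp at hi; omega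
    simp

theorem inv_eq_invWord {σ : Equiv.Perm (Fin n)} {w : ℕ → L}
    (h : ∀ i j : Fin n, i < j → (σ j < σ i ↔ w j < w i)) : inv σ = invWord n w := by
  rw [inv, invWord, Finset.sum_range, Finset.card_filter, Fintype.sum_prod_type_right]
  refine Finset.sum_congr rfl fun j _ => ?_
  rw [← Finset.card_filter]
  refine Finset.card_bij (fun i _ => (i : ℕ)) ?_ ?_ ?_
  · intro i hi
    simp only [Finset.mem_filter, Finset.mem_univ, true_and, Finset.mem_range] at hi ⊢
    exact ⟨hi.1, (h i j hi.1).1 hi.2⟩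
  · exact fun _ _ _ _ => Fin.ext
  · intro i hi
    simp only [Finset.mem_filter, Finset.mem_range] at hi
    have hi' : (⟨i, by omega⟩ : Fin n) < j := hi.1
    exact ⟨⟨i, by omega⟩, by simpa using ⟨hi', (h _ _ hi').2 hi.2⟩, rfl⟩

theorem inv_inv (σ : Equiv.Perm (Fin n)) : inv σ⁻¹ = inv σ := by
  refine Finset.card_bij (fun p _ => (σ⁻¹ p.2, σ⁻¹ p.1)) ?_ ?_ ?_
  · rintro ⟨a, b⟩ hp
    simpa [and_comm] using hp
  · rintro ⟨a, b⟩ - ⟨c, d⟩ - h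
    simp at h
    simp [h]
  · rintro ⟨a, b⟩ hp
    exact ⟨(σ b, σ a), by simpa [and_comm] using hp, by simp⟩

end Statistics

variable {R : Type*} [CommSemiring R] {n k m : ℕ}

/-! ### Splitting off the fixed points. -/

section Derangement

/-- The permutation of `Fin n` which fixes the elements of `S` and acts as `α` on the others. -/
def fixPerm (h : k + m = n) (S : {S : Finset (Fin n) // S.card = m}) (α : Equiv.Perm (Fin k)) :
    Equiv.Perm (Fin n) :=
  (subsetEquiv h S).symm.trans ((Equiv.sumCongr (1 : Equiv.Perm (Fin m)) α).trans (subsetEquiv h S))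

variable (h : k + m = n) (S : {S : Finset (Fin n) // S.card = m}) (α : Equiv.Perm (Fin k))

@[simp] theorem fixPerm_inl (a : Fin m) :
    fixPerm h S α (subsetEquiv h S (Sum.inl a)) = subsetEquiv h S (Sum.inl a) := by
  simp [fixPerm]

@[simp] theorem fixPerm_inr (b : Fin k) :
    fixPerm h S α (subsetEquiv h S (Sum.inr b)) = subsetEquiv h S (Sum.inr (α b)) := by
  simp [fixPerm]

theorem fix_eq_zero_iff : fix α = 0 ↔ ∀ i, α i ≠ i := by
  simp [fix, Finset.filter_eq_empty_iff]

theorem filter_fixPerm (hα : fix α = 0) :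
    (Finset.univ.filter fun i => fixPerm h S α i = i) = S.1 := by
  ext i
  obtain ⟨x, rfl⟩ := (subsetEquiv h S).surjective i
  rcases x with a | b
  · simp [subsetEquiv_inl_mem]
  · simp [subsetEquiv_inr_notMem, (fix_eq_zero_iff α).1 hα]

/-- The word which records the values of `α`, the values at subexcedances being moved below `0`. -/
def excWord (α : Equiv.Perm (Fin k)) (j : ℕ) : ℤ :=
  if hj : j < k then if α ⟨j, hj⟩ < ⟨j, hj⟩ then (α ⟨j, hj⟩ : ℤ) - k else (α ⟨j, hj⟩ : ℤ) + 1 else 1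

theorem excWord_coe (j : Fin k) :
    excWord α j = if α j < j then (α j : ℤ) - k else (α j : ℤ) + 1 := by
  simp [excWord]

/-- Subexcedances get negative letters and all other positions positive ones, including the default
beyond `k`; the letter `0` is left free for the fixed points. -/
theorem excWord_ne_zero (j : ℕ) : excWord α j ≠ 0 := by
  unfold excWord
  split_ifs with hj <;> omega

/-- At adjacent positions `i`, `i + 1`, an excedance value is at least `i + 1` and a following
subexcedance value at most `i`, a descent; in the opposite order there is an ascent. Separating the
two kinds of values therefore keeps every descent. -/
theorem maj_eq_majWord_excWord (hα : fix α = 0) : maj α = majWord k (excWord α) := by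
  refine maj_eq_majWord fun i j hij => ?_
  rw [fix_eq_zero_iff] at hα
  have hi := hα i
  have hj := hα j
  rw [excWord_coe, excWord_coe]
  simp only [Fin.lt_def, ne_eq, Fin.ext_iff] at *
  split_ifs <;> omega

/-- Next to a fixed point, an adjacent excedance has the larger value and an adjacent subexcedance
the smaller one, and two adjacent fixed points form no descent. So fixed points behave as equal
letters `0`. -/
theorem maj_fixPerm (hα : fix α = 0) : maj (fixPerm h S α) =
    majWord n (shuffle 0 (excWord α) (S.1.map Fin.valEmbedding)) := by
  refine maj_eq_majWord fun i j hij => ?_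
  rw [fix_eq_zero_iff] at hα
  obtain ⟨x, rfl⟩ := (subsetEquiv h S).surjective i
  obtain ⟨y, rfl⟩ := (subsetEquiv h S).surjective j
  have hne : ∀ a b, (subsetEquiv h S (Sum.inl a) : ℕ) ≠ subsetEquiv h S (Sum.inr b) := fun a b h' => by
    simpa using (subsetEquiv h S).injective (Fin.ext h')
  have hlt : ∀ b, (subsetEquiv h S (Sum.inr (α b)) : ℕ) < subsetEquiv h S (Sum.inr b) ↔ α b < b :=
    fun b => subsetEquiv_inr_lt_iff h S
  have hlt' : ∀ b, (subsetEquiv h S (Sum.inr b) : ℕ) < subsetEquiv h S (Sum.inr (α b)) ↔ b < α b :=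
    fun b => subsetEquiv_inr_lt_iff h S
  rcases x with a | b <;> rcases y with a' | b' <;>
    simp only [fixPerm_inl, fixPerm_inr, shuffle_subsetEquiv_inl, shuffle_subsetEquiv_inr,
      excWord_coe, Fin.lt_def (n := n)]
  · simp only [lt_self_iff_false, iff_false]; omega
  · have h1 := hne a (α b')
    have h2 := hlt b'
    split_ifs with h3 <;> simp only [h3, iff_true, iff_false] at h2 <;> omega
  · have h1 := hne a' (α b)
    have h2 := hlt b
    split_ifs with h3 <;> simp only [h3, iff_true, iff_false] at h2
    · omega
    · have h4 := (hlt' b).2 (lt_of_le_of_ne (not_lt.1 h3) (hα b).symm)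
      omega
  · have h1 := hlt b
    have h1' := hlt' b
    have h2 := hlt b'
    have h2' := hlt' b'
    have h3 : (subsetEquiv h S (Sum.inr (α b')) : ℕ) < subsetEquiv h S (Sum.inr (α b)) ↔ α b' < α b :=
      subsetEquiv_inr_lt_iff h S
    rw [h3]
    have h4 := hα b
    have h5 := hα b'
    simp only [Fin.lt_def (n := k), ne_eq, Fin.ext_iff (n := k)] at *
    split_ifs <;> omega

theorem fix_fixPerm (hα : fix α = 0) : fix (fixPerm h S α) = m := by
  rw [fix, filter_fixPerm h S α hα, S.2]

theorem exists_fixPerm_eq (σ : Equiv.Perm (Fin n)) (hσ : fix σ = m) :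
    ∃ S α, fix α = 0 ∧ fixPerm h S α = σ := by
  let S : {S : Finset (Fin n) // S.card = m} := ⟨_, hσ⟩
  have hS : ∀ i, i ∈ S.1 ↔ σ i = i := fun i => by simp [S]
  let e := subsetEquiv h S
  let τ : Equiv.Perm (Fin m ⊕ Fin k) := e.trans (σ.trans e.symm)
  have hτ : ∀ a, τ (Sum.inl a) = Sum.inl a := fun a => by
    simp [τ, e, (hS _).1 (subsetEquiv_inl_mem h S a)]
  -- Transported to `Fin m ⊕ Fin k`, `σ` preserves the left summand, so it splits as a sum; `α` is
  -- its action on the non-fixed points.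
  obtain ⟨⟨ρ, α⟩, hρ⟩ := Equiv.Perm.mem_sumCongrHom_range_of_perm_mapsTo_inl (σ := τ) (by
    rintro _ ⟨a, rfl⟩; exact ⟨a, (hτ a).symm⟩)
  have hα : ∀ b, σ (e (Sum.inr b)) = e (Sum.inr (α b)) := fun b => by
    have := congrArg e (DFunLike.congr_fun hρ (Sum.inr b))
    simpa [τ] using this.symm
  refine ⟨S, α, ?_, ?_⟩
  · rw [fix_eq_zero_iff]
    intro b hb
    refine subsetEquiv_inr_notMem h S b ((hS _).2 ?_)
    have := hα b
    rwa [hb] at this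
  · ext i : 1
    obtain ⟨x, rfl⟩ := e.surjective i
    rcases x with a | b
    · exact (fixPerm_inl h S α a).trans ((hS _).1 (subsetEquiv_inl_mem h S a)).symm
    · exact (fixPerm_inr h S α b).trans (hα b).symm

theorem sum_pow_maj_fix_eq (h : k + m = n) (q : R) :
    ∑ σ : Equiv.Perm (Fin n) with fix σ = m, q ^ maj σ =
      gaussBinom q k m * ∑ α : Equiv.Perm (Fin k) with fix α = 0, q ^ maj α := by
  calc ∑ σ : Equiv.Perm (Fin n) with fix σ = m, q ^ maj σ
      = ∑ p ∈ (Finset.univ : Finset (Equiv.Perm (Fin k))).filter (fix · = 0) ×ˢ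
          (Finset.univ : Finset {S : Finset (Fin n) // S.card = m}),
            q ^ maj (fixPerm h p.2 p.1) := by
        symm
        refine Finset.sum_nbij (fun p => fixPerm h p.2 p.1) ?_ ?_ ?_ fun _ _ => rfl
        · rintro ⟨α, S⟩ hp
          simp only [Finset.mem_product, Finset.mem_filter, Finset.mem_univ, true_and, and_true] at hp
          simpa using fix_fixPerm h S α hp
        · rintro ⟨α, S⟩ hp ⟨α', S'⟩ hp' heq
          simp only [Finset.coe_product, Finset.coe_filter, Finset.mem_univ, true_and, Set.mem_prod,
            Set.mem_ofPred_eq, Finset.coe_univ, Set.mem_univ, and_true] at hp hp' heq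
          obtain rfl : S = S' := Subtype.ext <| by
            rw [← filter_fixPerm h S α hp, heq, filter_fixPerm h S' α' hp']
          obtain rfl : α = α' := by
            ext1 b
            have := DFunLike.congr_fun heq (subsetEquiv h S (Sum.inr b))
            simpa using this
          rfl
        · intro σ hσ
          obtain ⟨S, α, hα, rfl⟩ := exists_fixPerm_eq h σ (by simpa using hσ)
          exact ⟨(α, S), by simpa using hα, rfl⟩
    _ = _ := by
        rw [Finset.sum_product, Finset.mul_sum]
        refine Finset.sum_congr rfl fun α hα => ?_
        have hα' : fix α = 0 := by simpa using hα
        simp only [maj_fixPerm h _ α hα']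
        rw [sum_subsets_eq fun S => q ^ majWord n (shuffle 0 (excWord α) S), ← h,
          sum_pow_majWord_shuffle q (excWord_ne_zero α), maj_eq_majWord_excWord α hα', mul_comm]

end Derangement

/-! ### Splitting off the pixed points. -/

section Pixed

/-- The position of an element of `Fin m ⊕ Fin k` in the concatenation of the two summands. -/
def concatEquiv (h : k + m = n) : Fin m ⊕ Fin k ≃ Fin n :=
  finSumFinEquiv.trans (finCongr (by omega))

@[simp] theorem coe_concatEquiv_inl (h : k + m = n) (a : Fin m) :
    (concatEquiv h (Sum.inl a) : ℕ) = a := by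
  simp [concatEquiv]

@[simp] theorem coe_concatEquiv_inr (h : k + m = n) (b : Fin k) :
    (concatEquiv h (Sum.inr b) : ℕ) = m + b := by
  simp [concatEquiv]

/-- The permutation whose word is the increasing word on `S` followed by the word of `δ` on the
complement of `S`. -/
def pixPerm (h : k + m = n) (S : {S : Finset (Fin n) // S.card = m}) (δ : Equiv.Perm (Fin k)) :
    Equiv.Perm (Fin n) :=
  (concatEquiv h).symm.trans
    ((Equiv.sumCongr (1 : Equiv.Perm (Fin m)) δ).trans (subsetEquiv h S))

variable (h : k + m = n) (S : {S : Finset (Fin n) // S.card = m}) (δ : Equiv.Perm (Fin k))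

@[simp] theorem pixPerm_inl (a : Fin m) :
    pixPerm h S δ (concatEquiv h (Sum.inl a)) = subsetEquiv h S (Sum.inl a) := by
  simp [pixPerm]

@[simp] theorem pixPerm_inr (b : Fin k) :
    pixPerm h S δ (concatEquiv h (Sum.inr b)) = subsetEquiv h S (Sum.inr (δ b)) := by
  simp [pixPerm]

@[simp] theorem pixPerm_inv_inl (a : Fin m) :
    (pixPerm h S δ)⁻¹ (subsetEquiv h S (Sum.inl a)) = concatEquiv h (Sum.inl a) := by
  rw [Equiv.Perm.inv_eq_iff_eq, pixPerm_inl]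

@[simp] theorem pixPerm_inv_inr (b : Fin k) :
    (pixPerm h S δ)⁻¹ (subsetEquiv h S (Sum.inr b)) = concatEquiv h (Sum.inr (δ⁻¹ b)) := by
  rw [Equiv.Perm.inv_eq_iff_eq, pixPerm_inr]
  simp

/-- The word of `δ⁻¹`, continued by `1`. -/
def invLetters (δ : Equiv.Perm (Fin k)) (j : ℕ) : ℕ :=
  if hj : j < k then (δ⁻¹ ⟨j, hj⟩ : ℕ) + 1 else 1

theorem invLetters_coe (j : Fin k) : invLetters δ j = (δ⁻¹ j : ℕ) + 1 := by
  simp [invLetters]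

/-- The shift by one and the default `1` keep all letters above the inserted letter `0`. -/
theorem invLetters_pos (j : ℕ) : 0 < invLetters δ j := by
  unfold invLetters
  split_ifs <;> omega

theorem inv_apply_lt_iff_invLetters (i j : Fin k) :
    δ⁻¹ j < δ⁻¹ i ↔ invLetters δ j < invLetters δ i := by
  simp [invLetters_coe]

/-- The inverse takes the smallest values `0, …, m - 1` on `S`, in increasing order. Replacing them
by equal minimal letters changes no inversion, so one shuffle describes both `imaj` and `inv`. -/
theorem pixPerm_inv_lt_iff {i j : Fin n} (hij : i < j) :
    (pixPerm h S δ)⁻¹ j < (pixPerm h S δ)⁻¹ i ↔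
      shuffle 0 (invLetters δ) (S.1.map Fin.valEmbedding) j <
        shuffle 0 (invLetters δ) (S.1.map Fin.valEmbedding) i := by
  obtain ⟨x, rfl⟩ := (subsetEquiv h S).surjective i
  obtain ⟨y, rfl⟩ := (subsetEquiv h S).surjective j
  rcases x with a | b <;> rcases y with a' | b' <;>
    simp only [pixPerm_inv_inl, pixPerm_inv_inr, shuffle_subsetEquiv_inl, shuffle_subsetEquiv_inr,
      invLetters_coe, Fin.lt_def (n := n), coe_concatEquiv_inl, coe_concatEquiv_inr]
  · have : (a : ℕ) < a' := (subsetEquiv_inl_lt_iff h S).1 hij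
    omega
  · omega
  · omega
  · omega

theorem imaj_pixPerm : imaj (pixPerm h S δ) =
    majWord n (shuffle 0 (invLetters δ) (S.1.map Fin.valEmbedding)) :=
  maj_eq_majWord fun _ _ hij => pixPerm_inv_lt_iff h S δ (Fin.lt_def.2 (by omega))

theorem inv_pixPerm : inv (pixPerm h S δ) =
    invWord n (shuffle 0 (invLetters δ) (S.1.map Fin.valEmbedding)) := by
  rw [← inv_inv]
  exact inv_eq_invWord fun _ _ hij => pixPerm_inv_lt_iff h S δ hij

theorem sum_pow_imaj_pixPerm (q : R) :
    ∑ S, q ^ imaj (pixPerm h S δ) = q ^ imaj δ * gaussBinom q k m := by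
  have : imaj δ = majWord k (invLetters δ) :=
    maj_eq_majWord fun i j _ => inv_apply_lt_iff_invLetters δ i j
  simp only [imaj_pixPerm]
  rw [sum_subsets_eq fun S => q ^ majWord n (shuffle 0 (invLetters δ) S), ← h,
    sum_pow_majWord_shuffle q fun i => (invLetters_pos δ i).ne', this]

theorem sum_pow_inv_pixPerm (q : R) :
    ∑ S, q ^ inv (pixPerm h S δ) = q ^ inv δ * gaussBinom q k m := by
  have : inv δ = invWord k (invLetters δ) := by
    rw [← inv_inv]
    exact inv_eq_invWord fun i j _ => inv_apply_lt_iff_invLetters δ i j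
  simp only [inv_pixPerm]
  rw [sum_subsets_eq fun S => q ^ invWord n (shuffle 0 (invLetters δ) S), ← h,
    sum_pow_invWord_shuffle q (invLetters_pos δ), this]

theorem pixPerm_injective {S S' : {S : Finset (Fin n) // S.card = m}} {δ δ' : Equiv.Perm (Fin k)}
    (heq : pixPerm h S δ = pixPerm h S' δ') : S = S' ∧ δ = δ' := by
  have hS : S = S' := by
    have hsub : S.1 ⊆ S'.1 := fun i hi => by
      obtain ⟨x, rfl⟩ := (subsetEquiv h S).surjective i
      obtain ⟨a, rfl⟩ := (subsetEquiv_mem_iff h S).1 hi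
      rw [← pixPerm_inl h S δ, heq, pixPerm_inl]
      exact subsetEquiv_inl_mem h S' a
    exact Subtype.ext (Finset.eq_of_subset_of_card_le hsub (by rw [S.2, S'.2]))
  subst hS
  refine ⟨rfl, ?_⟩
  ext1 b
  have := DFunLike.congr_fun heq (concatEquiv h (Sum.inr b))
  simpa using this

theorem pixPerm_lt {i j : Fin n} (hij : i < j) (hj : (j : ℕ) < m) :
    pixPerm h S δ i < pixPerm h S δ j := by
  have hi : (i : ℕ) < m := lt_trans hij hj
  have hi' : concatEquiv h (Sum.inl ⟨i, hi⟩) = i := Fin.ext (by simp)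
  have hj' : concatEquiv h (Sum.inl ⟨j, hj⟩) = j := Fin.ext (by simp)
  have := (subsetEquiv_inl_lt_iff h S (a := ⟨i, hi⟩) (b := ⟨j, hj⟩)).2 hij
  rwa [← pixPerm_inl h S δ, ← pixPerm_inl h S δ, hi', hj'] at this

theorem exists_pixPerm_eq (σ : Equiv.Perm (Fin n))
    (hσ : ∀ i j : Fin n, i < j → (j : ℕ) < m → σ i < σ j) : ∃ S δ, pixPerm h S δ = σ := by
  let f : Fin m → Fin n := fun a => σ (concatEquiv h (Sum.inl a))
  have hf : StrictMono f := fun a b hab => hσ _ _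
    (by rw [Fin.lt_def, coe_concatEquiv_inl, coe_concatEquiv_inl]; exact hab)
    (by rw [coe_concatEquiv_inl]; exact b.2)
  -- The set of values of the first `m` letters of `σ`; as these increase, they enumerate it in
  -- order.
  let S : {S : Finset (Fin n) // S.card = m} :=
    ⟨Finset.univ.map ⟨f, hf.injective⟩, by simp⟩
  have hS : ∀ a, f a = subsetEquiv h S (Sum.inl a) := fun a =>
    congrFun (Finset.orderEmbOfFin_unique S.2 (f := f) (fun x => by simp [S]) hf) a
  let e := subsetEquiv h S
  let τ : Equiv.Perm (Fin m ⊕ Fin k) := (concatEquiv h).trans (σ.trans e.symm)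
  have hτ : ∀ a, τ (Sum.inl a) = Sum.inl a := fun a => e.symm_apply_eq.2 (hS a)
  obtain ⟨⟨ρ, δ⟩, hρ⟩ := Equiv.Perm.mem_sumCongrHom_range_of_perm_mapsTo_inl (σ := τ) (by
    rintro _ ⟨a, rfl⟩; exact ⟨a, (hτ a).symm⟩)
  refine ⟨S, δ, ?_⟩
  ext i : 1
  obtain ⟨x, rfl⟩ := (concatEquiv h).surjective i
  rcases x with a | b
  · rw [pixPerm_inl]
    exact (hS a).symm
  · have := congrArg e (DFunLike.congr_fun hρ (Sum.inr b))
    rw [pixPerm_inr]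
    simpa [τ, e] using this

/-- Being a desarrangement depends only on the relative order of the letters, and the right factor
of `pixPerm h S δ` is an increasing relabelling of the word of `δ`. -/
theorem pix_pixPerm_eq_iff : pix (pixPerm h S δ) = m ↔ pix δ = 0 := by
  rw [pix_eq_iff _ (by omega), pix_eq_iff _ (Nat.zero_le k)]
  simp only [Nat.not_lt_zero, false_imp_iff, imp_true_iff, true_and, List.drop_zero]
  rw [and_iff_right fun i j => pixPerm_lt h S δ]
  have h1 : word δ = (List.ofFn δ).map fun i : Fin k => (i : ℕ) + 1 := by
    simp [word, List.map_ofFn, Function.comp_def]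
  have h2 : (word (pixPerm h S δ)).drop m =
      (List.ofFn δ).map fun i : Fin k => (subsetEquiv h S (Sum.inr i) : ℕ) + 1 := by
    refine List.ext_getElem (by simp; omega) fun i hi hi' => ?_
    have hik : i < k := by simpa using hi'
    have : (⟨m + i, by omega⟩ : Fin n) = concatEquiv h (Sum.inr ⟨i, hik⟩) := Fin.ext (by simp)
    simp [this]
  rw [h1, h2, isDesarrangement_map, isDesarrangement_map]
  · intro a b hab
    simpa using hab
  · intro a b hab
    have : (subsetEquiv h S (Sum.inr a) : ℕ) < subsetEquiv h S (Sum.inr b) :=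
      (subsetEquiv_inr_lt_iff h S).2 hab
    simpa using this

theorem sum_filter_eq_sum_pixPerm (h : k + m = n) {P : Equiv.Perm (Fin n) → Prop} [DecidablePred P]
    {Q : Equiv.Perm (Fin k) → Prop} [DecidablePred Q]
    (hP : ∀ σ, P σ → ∀ i j : Fin n, i < j → (j : ℕ) < m → σ i < σ j)
    (hPQ : ∀ S δ, P (pixPerm h S δ) ↔ Q δ) (F : Equiv.Perm (Fin n) → R) :
    ∑ σ with P σ, F σ = ∑ δ with Q δ, ∑ S, F (pixPerm h S δ) := by
  rw [← Finset.sum_product' _ _ fun δ S => F (pixPerm h S δ)]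
  symm
  refine Finset.sum_nbij (fun p => pixPerm h p.2 p.1) ?_ ?_ ?_ fun _ _ => rfl
  · rintro ⟨δ, S⟩ hp
    simpa [hPQ] using hp
  · rintro ⟨δ, S⟩ - ⟨δ', S'⟩ - heq
    obtain ⟨rfl, rfl⟩ := pixPerm_injective h heq
    rfl
  · intro σ hσ
    have hσ' : P σ := by simpa using hσ
    obtain ⟨S, δ, rfl⟩ := exists_pixPerm_eq h σ (hP σ hσ')
    exact ⟨(δ, S), by simpa [hPQ] using hσ', rfl⟩

theorem sum_pow_imaj_pix_eq (h : k + m = n) (q : R) :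
    ∑ σ : Equiv.Perm (Fin n) with pix σ = m, q ^ imaj σ =
      gaussBinom q k m * ∑ δ : Equiv.Perm (Fin k) with pix δ = 0, q ^ imaj δ := by
  rw [sum_filter_eq_sum_pixPerm h (fun σ hσ => ((pix_eq_iff σ (by omega)).1 hσ).1)
    (pix_pixPerm_eq_iff h), Finset.mul_sum]
  exact Finset.sum_congr rfl fun δ _ => by rw [sum_pow_imaj_pixPerm, mul_comm]

theorem sum_pow_inv_pix_eq (h : k + m = n) (q : R) :
    ∑ σ : Equiv.Perm (Fin n) with pix σ = m, q ^ inv σ =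
      gaussBinom q k m * ∑ δ : Equiv.Perm (Fin k) with pix δ = 0, q ^ inv δ := by
  rw [sum_filter_eq_sum_pixPerm h (fun σ hσ => ((pix_eq_iff σ (by omega)).1 hσ).1)
    (pix_pixPerm_eq_iff h), Finset.mul_sum]
  exact Finset.sum_congr rfl fun δ _ => by rw [sum_pow_inv_pixPerm, mul_comm]

/-- For `m = 1` the left factor is a single letter and the increasing condition is vacuous, so every
permutation arises. -/
theorem sum_eq_sum_pixPerm_one (F : Equiv.Perm (Fin (n + 1)) → R) :
    ∑ σ, F σ = ∑ δ : Equiv.Perm (Fin n), ∑ S, F (pixPerm (m := 1) rfl S δ) := by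
  simpa using sum_filter_eq_sum_pixPerm (m := 1) (P := fun _ => True) (Q := fun _ => True)
    (rfl : n + 1 = n + 1) (fun σ _ i j hij hj => by rw [Fin.lt_def] at hij; omega)
    (fun _ _ => Iff.rfl) F

/-- The inverse major index and the number of inversions are equidistributed. -/
theorem sum_pow_imaj_eq_sum_pow_inv (n : ℕ) (q : R) :
    ∑ σ : Equiv.Perm (Fin n), q ^ imaj σ = ∑ σ : Equiv.Perm (Fin n), q ^ inv σ := by
  induction n with
  | zero => simp [imaj, iligne, ligne, inv]
  | succ n ih =>
    -- Summing over the first letter gives the same factor `gaussBinom q n 1` on both sides.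
    rw [sum_eq_sum_pixPerm_one, sum_eq_sum_pixPerm_one]
    simp only [sum_pow_imaj_pixPerm, sum_pow_inv_pixPerm]
    rw [← Finset.sum_mul, ih, Finset.sum_mul]

theorem sum_pow_maj_eq_sum_pow_imaj (n : ℕ) (q : R) :
    ∑ σ : Equiv.Perm (Fin n), q ^ maj σ = ∑ σ : Equiv.Perm (Fin n), q ^ imaj σ :=
  (Equiv.sum_comp (Equiv.inv (Equiv.Perm (Fin n))) fun σ => q ^ maj σ).symm

end Pixed

/-! ### Comparison of the expansions. -/

section GeneratingFunctions

variable {s p s' p' : ∀ {n : ℕ}, Equiv.Perm (Fin n) → ℕ}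

theorem sum_pow_mul_pow_eq (q Y : R) (hp : ∀ {n} (σ : Equiv.Perm (Fin n)), p σ ≤ n)
    (hs : ∀ {n k m : ℕ}, k + m = n → ∑ σ : Equiv.Perm (Fin n) with p σ = m, q ^ s σ =
      gaussBinom q k m * ∑ α : Equiv.Perm (Fin k) with p α = 0, q ^ s α) (n : ℕ) :
    ∑ σ : Equiv.Perm (Fin n), q ^ s σ * Y ^ p σ =
      ∑ x ∈ Finset.HasAntidiagonal.antidiagonal n, gaussBinom q x.1 x.2 *
        (∑ α : Equiv.Perm (Fin x.1) with p α = 0, q ^ s α) * Y ^ x.2 := by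
  rw [← Finset.sum_fiberwise_of_maps_to (t := Finset.HasAntidiagonal.antidiagonal n)
    (g := fun σ : Equiv.Perm (Fin n) => (n - p σ, p σ))
    fun σ _ => by simpa using Nat.sub_add_cancel (hp σ)]
  refine Finset.sum_congr rfl fun x hx => ?_
  have hx' := Finset.HasAntidiagonal.mem_antidiagonal.1 hx
  have hfib : ∀ σ : Equiv.Perm (Fin n), (n - p σ, p σ) = x ↔ p σ = x.2 := fun σ => by
    rw [Prod.ext_iff]
    exact ⟨fun h => h.2, fun h => ⟨by simp only; omega, h⟩⟩
  simp only [hfib]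
  rw [← hs hx', Finset.sum_mul]
  refine Finset.sum_congr rfl fun σ hσ => ?_
  rw [(Finset.mem_filter.1 hσ).2]

/-- The term `(n, 0)` has coefficient `1` and all others involve smaller indices, so strong
induction cancels them. -/
theorem eq_of_sum_gaussBinom_mul_eq [IsRightCancelAdd R] {q : R} {A B : ℕ → R}
    (h : ∀ n, ∑ x ∈ Finset.HasAntidiagonal.antidiagonal n, gaussBinom q x.1 x.2 * A x.1 =
      ∑ x ∈ Finset.HasAntidiagonal.antidiagonal n, gaussBinom q x.1 x.2 * B x.1) (n : ℕ) :
    A n = B n := by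
  induction n using Nat.strong_induction_on with
  | _ n ih =>
    have hmem : (n, 0) ∈ Finset.HasAntidiagonal.antidiagonal n := by simp
    have herase : ∑ x ∈ (Finset.HasAntidiagonal.antidiagonal n).erase (n, 0),
        gaussBinom q x.1 x.2 * A x.1 =
        ∑ x ∈ (Finset.HasAntidiagonal.antidiagonal n).erase (n, 0),
          gaussBinom q x.1 x.2 * B x.1 := by
      refine Finset.sum_congr rfl fun x hx => ?_
      obtain ⟨h1, h2⟩ := Finset.mem_erase.1 hx
      have h3 := Finset.HasAntidiagonal.mem_antidiagonal.1 h2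
      rw [ih x.1 (by
        by_contra h4
        exact h1 (Prod.ext (by simp only; omega) (by simp only; omega)))]
    have hn := h n
    rw [← Finset.add_sum_erase _ _ hmem, ← Finset.add_sum_erase _ _ hmem, herase] at hn
    simpa using add_right_cancel hn

open Polynomial in
theorem sum_pow_mul_pow_congr (q Y : R)
    (hp : ∀ {n} (σ : Equiv.Perm (Fin n)), p σ ≤ n) (hp' : ∀ {n} (σ : Equiv.Perm (Fin n)), p' σ ≤ n)
    (hsX : ∀ {n k m : ℕ}, k + m = n → ∑ σ : Equiv.Perm (Fin n) with p σ = m, (X : ℕ[X]) ^ s σ =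
      gaussBinom X k m * ∑ α : Equiv.Perm (Fin k) with p α = 0, X ^ s α)
    (hsX' : ∀ {n k m : ℕ}, k + m = n → ∑ σ : Equiv.Perm (Fin n) with p' σ = m, (X : ℕ[X]) ^ s' σ =
      gaussBinom X k m * ∑ α : Equiv.Perm (Fin k) with p' α = 0, X ^ s' α)
    (hs : ∀ {n k m : ℕ}, k + m = n → ∑ σ : Equiv.Perm (Fin n) with p σ = m, q ^ s σ =
      gaussBinom q k m * ∑ α : Equiv.Perm (Fin k) with p α = 0, q ^ s α)
    (hs' : ∀ {n k m : ℕ}, k + m = n → ∑ σ : Equiv.Perm (Fin n) with p' σ = m, q ^ s' σ =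
      gaussBinom q k m * ∑ α : Equiv.Perm (Fin k) with p' α = 0, q ^ s' α)
    (htotal : ∀ n, ∑ σ : Equiv.Perm (Fin n), (X : ℕ[X]) ^ s σ = ∑ σ : Equiv.Perm (Fin n), X ^ s' σ)
    (n : ℕ) :
    ∑ σ : Equiv.Perm (Fin n), q ^ s σ * Y ^ p σ = ∑ σ : Equiv.Perm (Fin n), q ^ s' σ * Y ^ p' σ := by
  have hX : ∀ k, ∑ α : Equiv.Perm (Fin k) with p α = 0, (X : ℕ[X]) ^ s α =
      ∑ α : Equiv.Perm (Fin k) with p' α = 0, X ^ s' α := by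
    -- Cancellation may fail in `R`, but it holds coefficientwise in `ℕ[X]`.
    have : IsRightCancelAdd ℕ[X] := ⟨fun a b c h => by
      ext i
      have := congrArg (coeff · i) h
      simpa using this⟩
    refine eq_of_sum_gaussBinom_mul_eq (q := X) fun n => ?_
    have h1 := sum_pow_mul_pow_eq (s := s) (p := p) (X : ℕ[X]) 1 hp hsX n
    have h2 := sum_pow_mul_pow_eq (s := s') (p := p') (X : ℕ[X]) 1 hp' hsX' n
    simp only [one_pow, mul_one] at h1 h2
    rw [← h1, ← h2, htotal]
  have hq : ∀ k, ∑ α : Equiv.Perm (Fin k) with p α = 0, q ^ s α =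
      ∑ α : Equiv.Perm (Fin k) with p' α = 0, q ^ s' α := fun k => by
    simpa using congrArg (eval₂RingHom (Nat.castRingHom R) q) (hX k)
  rw [sum_pow_mul_pow_eq (s := s) (p := p) q Y hp hs,
    sum_pow_mul_pow_eq (s := s') (p := p') q Y hp' hs']
  simp only [hq]

theorem fix_le (σ : Equiv.Perm (Fin n)) : fix σ ≤ n :=
  (Finset.card_le_univ _).trans_eq (Fintype.card_fin n)

end GeneratingFunctions

end PermStat

theorem mainTheorem7 {R : Type*} [CommSemiring R] (n : ℕ) (q Y₀ : R) :
    (∑ σ : Equiv.Perm (Fin n), q ^ PermStat.maj σ * Y₀ ^ PermStat.fix σ =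
      ∑ σ : Equiv.Perm (Fin n), q ^ PermStat.inv σ * Y₀ ^ PermStat.pix σ) ∧
    (∑ σ : Equiv.Perm (Fin n), q ^ PermStat.inv σ * Y₀ ^ PermStat.pix σ =
      ∑ σ : Equiv.Perm (Fin n), q ^ PermStat.imaj σ * Y₀ ^ PermStat.pix σ) := by
  open PermStat in
  constructor
  · exact sum_pow_mul_pow_congr (s := maj) (p := fix) (s' := inv) (p' := pix) q Y₀ fix_le pix_le
      (fun h => sum_pow_maj_fix_eq h _) (fun h => sum_pow_inv_pix_eq h _)
      (fun h => sum_pow_maj_fix_eq h _) (fun h => sum_pow_inv_pix_eq h _)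
      -- MacMahon's theorem: `σ ↦ σ⁻¹` exchanges `maj` and `imaj`, and `imaj` is equidistributed
      -- with `inv`.
      (fun n => (sum_pow_maj_eq_sum_pow_imaj n _).trans (sum_pow_imaj_eq_sum_pow_inv n _)) n
  · exact sum_pow_mul_pow_congr (s := inv) (p := pix) (s' := imaj) (p' := pix) q Y₀ pix_le pix_le
      (fun h => sum_pow_inv_pix_eq h _) (fun h => sum_pow_imaj_pix_eq h _)
      (fun h => sum_pow_inv_pix_eq h _) (fun h => sum_pow_imaj_pix_eq h _)
      (fun n => (sum_pow_imaj_eq_sum_pow_inv n _).symm) n
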